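/- **Setting.** Nodes $0,1,\dots,m$ form a chain. At each time step $i=1,\dots,n$, every node $j\in\{0,\dots,m-1\}$ sends one bit to node $j+1$ over a binary symmetric channel with crossover probability $p$; all channel uses are independent, and what relay node $j$ sends at time $i$ depends only on what it received at times $1,\dots,i-1$. Node $0$ is given a message of $k\ge 1$ bits, and after $n$ steps node $m$ outputs an estimate of it; an error occurs if the estimate differs from the message. **Parameters.** For $l\ge 1$ let $t_l=(l+2)^2$ and $b_l=\lfloor (l+2)^2/4\rfloor$. Let $r_l=\lceil\log_2 b_l\rceil+1$ for $l\ge 2$ and $r_1=3$ (so $b_1=2$). Put $k_l=\prod_{i=1}^l b_i$, $n_l=\prod_{i=1}^l (b_i+r_i)$ and $T_l=\prod_{i=1}^l t_i$, with $k_0=n_0=T_0=1$. **Coding.** Level-$0$ encoding and decoding are the identity on one bit. For $l\ge 1$, the level-$l$ encoder splits $k_l$ bits into $b_l$ blocks of $k_{l-1}$ bits, appends $r_l$ redundancy blocks by applying, in each of the $k_{l-1}$ positions separately, the systematic (shortened) Hamming code with $b_l$ data bits and $r_l$ parity bits, and encodes each of the $b_l+r_l$ blocks at level $l-1$; this gives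 $n_l$ bits. The level-$l$ decoder splits $n_l$ bits into $b_l+r_l$ blocks of $n_{l-1}$ bits, decodes each at level $l-1$, and then applies in each position the syndrome decoder of the Hamming code, which corrects one error. **Protocol.** A relay node $j\in\{1,\dots,m-1\}$ has level $l(j)$, the largest $l$ with $T_l\mid j$. Let $L'$ be the largest level of a relay node ($0$ if there are none), let $L$ satisfy $k_L\le k<k_{L+1}$, and let $M=\max\{L,L'\}$. Node $0$ pads the message with zeros to $\lceil k/k_M\rceil$ blocks of $k_M$ bits, encodes each block at level $M$ and sends the result, starting at time $1$. Relay node $j$ ignores what it receives before the first bit that node $j-1$ meaningfully sends; from then on it reads successive blocks of $n_{l(j)}$ bits, decodes and re-encodes each at level $l(j)$, and sends the result, starting as soon as it has read its first block. Node $m$ decodes the blocks at level $M$. The total transmission time is thus $$n(m,k)=\sum_{j=1}^{m-1} n_{l(j)}+\lceil k/k_M\rceil\, n_M .$$ **Theorem.** There is a constant $C$ such that $n(m,k)\le C(m+k)$ for all $m,k\ge 1$. Moreover, if $p<3^{-8}/4$, then the error probability of this protocol tends to $0$ as $m\to\infty$, uniformly in $k\ge 1$ and in the message: for every $\varepsilon>0$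 there is an $m_0$ such that for all $m\ge m_0$, all $k\ge 1$ and every message of $k$ bits, the error probability is at most $\varepsilon$. -/

import Mathlib

open MeasureTheory ProbabilityTheory

namespace RelayChain

/-! ### The tandem of binary symmetric channels

Bits are elements of `ZMod 2`, so that XOR is addition. There are nodes `0, …, m`, and channel `j`
leads from node `j` to node `j + 1`. There are `n` time steps, numbered `0, …, n - 1`. -/

/-- A deterministic protocol that transmits `k` bits over `m` hops in `n` time steps.
What node `j` sends at time step `i` depends only on what it received at time steps `0, …, i - 1`
(the entry `j = 0` of `relay` is not used: node `0` is the encoder). -/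
structure Protocol (k m n : ℕ) where
  /-- the bit that node `0` sends at each time step, given the message -/
  encoder : (Fin k → ZMod 2) → Fin n → ZMod 2
  /-- the bit that relay node `j` sends at time step `i`, given what it received before -/
  relay : Fin m → (i : Fin n) → (Fin (i : ℕ) → ZMod 2) → ZMod 2
  /-- the estimate of the message that node `m` forms after `n` time steps -/
  decoder : (Fin n → ZMod 2) → Fin k → ZMod 2

/-- The bit that is added to the transmitted bit by a channel: `1` if the channel flips it. -/
def flipBit (z : Bool) : ZMod 2 := if z then 1 else 0

/-- The output of channel `j` at time step `i`, i.e. what node `j + 1` receives, when node `0` is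
given the message `msg` and `z (j, i)` tells whether channel `j` flips its bit at time step `i`. -/
def Protocol.received {k m n : ℕ} (P : Protocol k m n) (msg : Fin k → ZMod 2)
    (z : Fin m × Fin n → Bool) : (j : ℕ) → j < m → Fin n → ZMod 2
  | 0, h, i => P.encoder msg i + flipBit (z (⟨0, h⟩, i))
  | j + 1, h, i =>
      P.relay ⟨j + 1, h⟩ i
        (fun i' => P.received msg z j (Nat.lt_of_succ_lt h) ⟨i', i'.isLt.trans i.isLt⟩)
      + flipBit (z (⟨j + 1, h⟩, i))

/-- The estimate of the message that node `m` outputs. -/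
def Protocol.estimate {k m n : ℕ} (P : Protocol k m n) (hm : 0 < m) (msg : Fin k → ZMod 2)
    (z : Fin m × Fin n → Bool) : Fin k → ZMod 2 :=
  P.decoder (P.received msg z (m - 1) (Nat.sub_lt hm Nat.one_pos))

/-- The law of the channel noise: all flips are independent, each has probability `p`. -/
noncomputable def noise (m n : ℕ) (p : unitInterval) : Measure (Fin m × Fin n → Bool) :=
  Measure.pi fun _ => bernoulliMeasure true false p

/-- The probability that the estimate differs from the message `msg`. -/
noncomputable def Protocol.errorProb {k m n : ℕ} (P : Protocol k m n) (hm : 0 < m)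
    (p : unitInterval) (msg : Fin k → ZMod 2) : ℝ :=
  (noise m n p).real {z | P.estimate hm msg z ≠ msg}

/-! ### The single-error-correcting (shortened) Hamming code -/

/-- The number of redundancy positions that are added to `b ≥ 1` data positions:
`⌈log₂ b⌉ + 1` for `b ≥ 3`, one more for `b ≤ 2` (where fewer cannot correct an error). -/
def redundancy (b : ℕ) : ℕ := if b ≤ 2 then Nat.clog 2 b + 2 else Nat.clog 2 b + 1

/-- The label of position `c` of the code with `b` data positions, followed by redundancy
positions. The data positions are labelled `3, 5, 6, 7, 9, …` (the positive integers that are not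
powers of two, in increasing order), the redundancy positions `1, 2, 4, 8, …`. -/
noncomputable def label (b c : ℕ) : ℕ :=
  if c < b then Nat.nth (fun x => 0 < x ∧ ∀ i : ℕ, x ≠ 2 ^ i) c else 2 ^ (c - b)

/-- The parity-check matrix: its column `c` is the binary expansion of the label of `c`. -/
noncomputable def parityCheck (b j c : ℕ) : ZMod 2 := if (label b c).testBit j then 1 else 0

/-- Position `c` of the codeword of the data word `v`. -/
noncomputable def hammingEncode (b : ℕ) (v : ℕ → ZMod 2) (c : ℕ) : ZMod 2 :=
  if c < b then v c else ∑ d ∈ Finset.range b, parityCheck b (c - b) d * v d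

/-- Parity check `j` of a received word `w`. -/
noncomputable def syndrome (b : ℕ) (w : ℕ → ZMod 2) (j : ℕ) : ZMod 2 :=
  ∑ c ∈ Finset.range (b + redundancy b), parityCheck b j c * w c

open scoped Classical in
/-- The data bit `d` that is decoded from the received word `w`: it is flipped if the syndrome is
column `d` of the parity-check matrix. -/
noncomputable def hammingDecode (b : ℕ) (w : ℕ → ZMod 2) (d : ℕ) : ZMod 2 :=
  w d + if ∀ j < redundancy b, syndrome b w j = parityCheck b j d then 1 else 0

/-! ### The recursive encoder and decoder

The sequence `b 1, b 2, …` gives the numbers of data blocks; `b 0` is not used. -/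

/-- The number of message bits of a level-`l` block. -/
def msgLen (b : ℕ → ℕ) (l : ℕ) : ℕ := ∏ i ∈ Finset.Icc 1 l, b i

/-- The number of transmitted bits of a level-`l` block. -/
def codeLen (b : ℕ → ℕ) (l : ℕ) : ℕ := ∏ i ∈ Finset.Icc 1 l, (b i + redundancy (b i))

/-- Level-`l` encoding. Only the first `msgLen b l` bits of the argument and the first
`codeLen b l` bits of the value are meaningful. The message bits are split into `b l` blocks, to
which redundancy blocks are added by applying the Hamming code in each position of the blocks
separately; then each of the blocks is encoded at level `l - 1`. -/
noncomputable def encode (b : ℕ → ℕ) : ℕ → (ℕ → ZMod 2) → ℕ → ZMod 2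
  | 0, u => u
  | l + 1, u => fun i =>
      encode b l
        (fun x => hammingEncode (b (l + 1)) (fun d => u (d * msgLen b l + x)) (i / codeLen b l))
        (i % codeLen b l)

/-- Level-`l` decoding. Only the first `codeLen b l` bits of the argument and the first
`msgLen b l` bits of the value are meaningful. Each of the blocks (including the redundancy blocks)
is decoded at level `l - 1`; then the Hamming code is decoded in each position separately. -/
noncomputable def decode (b : ℕ → ℕ) : ℕ → (ℕ → ZMod 2) → ℕ → ZMod 2
  | 0, y => y
  | l + 1, y => fun i =>
      hammingDecode (b (l + 1))
        (fun c => decode b l (fun s => y (c * codeLen b l + s)) (i % msgLen b l))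
        (i / msgLen b l)

/-! ### The full protocol

The sequence `t 1, t 2, …` gives the arrangement of the nodes in levels; `t 0` is not used. -/

/-- The level of a relay node `j ≥ 1`: the largest `l` such that `t 1 * ⋯ * t l` divides `j`
(when all `t i ≥ 2`, every such `l` is less than `j`). -/
def level (t : ℕ → ℕ) (j : ℕ) : ℕ := Nat.findGreatest (fun l => ∏ i ∈ Finset.Icc 1 l, t i ∣ j) j

/-- The maximum level of the relay nodes `1, …, m - 1` (and `0` if there are none). -/
def maxRelayLevel (t : ℕ → ℕ) (m : ℕ) : ℕ := (Finset.Icc 1 (m - 1)).sup (level t)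

/-- The level `l` with `msgLen b l ≤ k < msgLen b (l + 1)`
(when all `b i ≥ 2`, this level is less than `k`). -/
def msgLevel (b : ℕ → ℕ) (k : ℕ) : ℕ := Nat.findGreatest (fun l => msgLen b l ≤ k) k

/-- The level at which nodes `0` and `m` operate. -/
def topLevel (b t : ℕ → ℕ) (m k : ℕ) : ℕ := max (msgLevel b k) (maxRelayLevel t m)

/-- The number of top-level blocks into which the message, padded with zeros to a multiple of the
top-level message length, is split. This is `1` if the message is shorter than that length. -/
def numBlocks (b t : ℕ → ℕ) (m k : ℕ) : ℕ := k ⌈/⌉ msgLen b (topLevel b t m k)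

/-- Relay node `j` starts to transmit at time step `delay b t j` (so does node `0`, at time step
`0`): every relay node waits for one block of its own level. Hence the first meaningful bit of
node `j` reaches node `j + 1` at time step `delay b t j`. -/
def delay (b t : ℕ → ℕ) (j : ℕ) : ℕ := ∑ j' ∈ Finset.Icc 1 j, codeLen b (level t j')

/-- The total transmission time: the propagation delay up to node `m - 1`, plus the number of bits
that node `0` has to send. -/
def transmissionTime (b t : ℕ → ℕ) (m k : ℕ) : ℕ :=
  delay b t (m - 1) + numBlocks b t m k * codeLen b (topLevel b t m k)

/-- The protocol that transmits `k` bits over `m` hops. -/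
noncomputable def multiBitProtocol (b t : ℕ → ℕ) (m k : ℕ) :
    Protocol k m (transmissionTime b t m k) where
  -- The message is padded with zeros and encoded block by block.
  encoder msg i :=
    let l := topLevel b t m k
    encode b l
      (fun x =>
        let d := (i : ℕ) / codeLen b l * msgLen b l + x
        if h : d < k then msg ⟨d, h⟩ else 0)
      ((i : ℕ) % codeLen b l)
  -- From time step `delay b t j` on, a relay node transmits, block by block, the re-encoding of the
  -- decoded block; the block itself arrives from time step `delay b t (j - 1)` on.
  relay j i y :=
    if (i : ℕ) < delay b t j then 0
    else
      let l := level t j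
      let q := (i : ℕ) - delay b t j
      encode b l
        (decode b l fun s =>
          let r := delay b t ((j : ℕ) - 1) + q / codeLen b l * codeLen b l + s
          if h : r < (i : ℕ) then y ⟨r, h⟩ else 0)
        (q % codeLen b l)
  -- The received bits, from time step `delay b t (m - 1)` on, are decoded block by block.
  decoder y d :=
    let l := topLevel b t m k
    decode b l
      (fun s =>
        let r := delay b t (m - 1) + (d : ℕ) / msgLen b l * codeLen b l + s
        if h : r < transmissionTime b t m k then y ⟨r, h⟩ else 0)
      ((d : ℕ) % msgLen b l)

/-- The arrangement of levels `t l = (l + 2)²`. -/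
def tSeq (l : ℕ) : ℕ := (l + 2) ^ 2

/-- The numbers of data blocks `b l = ⌊(l + 2)² / 4⌋`. -/
def bSeq (l : ℕ) : ℕ := (l + 2) ^ 2 / 4

end RelayChain

namespace RelayChain

/-! ### The Hamming code corrects one error -/

/-! A level-`l` block is a rectangle: `hopLen t l` consecutive channels times `codeLen b l`
consecutive stream positions. It is tiled by `t l * (b l + redundancy (b l))` rectangles of level `l
- 1`. Each of these touches only one of the blocks that the Hamming code combines, so damage in a
single one is repaired. Hence a rectangle can fail only if two of its tiles fail, which is what
`Corrupt` records; `decode_of_not_corrupt` is this deterministic part.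

Unfolded, corruption at level `l` requires `2 ^ l` distinct flips in one of at most `corruptCount b
t l` patterns, so a union bound suffices (`noise_corrupt_le`). For the given parameters a level-`l`
rectangle has at most `5/9 * (l+2)^4` tiles; the bounds `e l` satisfy `e l ≤ (5/9 * (l+2)^4)^2 * (e
(l-1))^2`, and the assumption on `p` starts an induction giving `e l ≤ 1 / (4 * (l+3)^8)`. At the
top level `M` there are at most `(M+3)^2` segments and as many message blocks, so the total tends to
`0` as `M` grows; and `M` grows with `m` whatever `k` is, because `m ≤ hopLen t (M + 1)`.

For the time, at most a fraction `1 / hopLen t l` of the relays have level at least `l`, and each of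
level `l` costs `codeLen b l ≤ (5/9)^l * hopLen t l`: the delays form a geometric series
(`delay_le`). The ratios of redundancy to data are summable, so the code rates stay bounded below
(`exists_codeLen_le`) and the final term is linear too. -/

theorem infinite_not_two_pow : {x : ℕ | 0 < x ∧ ∀ i : ℕ, x ≠ 2 ^ i}.Infinite := by
  refine Set.infinite_of_forall_exists_gt fun n => ⟨2 * n + 3, ⟨by omega, fun i => ?_⟩, by omega⟩
  cases i with
  | zero => simp
  | succ i => rw [pow_succ]; omega

-- Below `2 ^ r` only `0` and the `r` powers `2 ^ 0, …, 2 ^ (r - 1)` are excluded as data labels.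
open scoped Classical in
theorem count_not_two_pow (r : ℕ) :
    2 ^ r ≤ Nat.count (fun x => 0 < x ∧ ∀ i : ℕ, x ≠ 2 ^ i) (2 ^ r) + (r + 1) := by
  have h : Finset.range (2 ^ r) ⊆
      {x ∈ Finset.range (2 ^ r) | 0 < x ∧ ∀ i : ℕ, x ≠ 2 ^ i} ∪
        insert 0 ((Finset.range r).image fun i => 2 ^ i) := by
    intro x hx
    rw [Finset.mem_range] at hx
    simp only [Finset.mem_union, Finset.mem_filter, Finset.mem_range, Finset.mem_insert,
      Finset.mem_image]
    by_cases h0 : x = 0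
    · exact Or.inr (Or.inl h0)
    by_cases h1 : ∃ i, x = 2 ^ i
    · obtain ⟨i, rfl⟩ := h1
      exact Or.inr (Or.inr ⟨i, (Nat.pow_lt_pow_iff_right (by norm_num)).1 hx, rfl⟩)
    · push Not at h1
      exact Or.inl ⟨hx, Nat.pos_of_ne_zero h0, h1⟩
  have h2 := (Finset.card_le_card h).trans (Finset.card_union_le _ _)
  have h3 := (Finset.card_insert_le 0 ((Finset.range r).image fun i => 2 ^ i)).trans
    (Nat.add_le_add_right Finset.card_image_le 1)
  rw [Finset.card_range] at h2 h3
  rw [Nat.count_eq_card_filter_range]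
  convert h2.trans (Nat.add_le_add_left h3 _) using 4

/-- This is the Hamming bound: the columns can be distinct nonzero vectors of `redundancy b` bits.
For `b ≥ 3` and `c = Nat.clog 2 b` it follows from `b ≤ 2 ^ c` and `c + 2 ≤ 2 ^ c`. -/
theorem data_add_redundancy_lt (b : ℕ) : b + redundancy b < 2 ^ redundancy b := by
  unfold redundancy
  have h := Nat.le_pow_clog (b := 2) (by norm_num) b
  split_ifs with hb
  · have h1 : Nat.clog 2 2 = 1 := Nat.clog_eq_one le_rfl le_rfl
    interval_cases b <;> simp [h1]
  · have h2 : 1 < Nat.clog 2 b := (Nat.lt_clog_iff_pow_lt (by norm_num)).2 (by omega)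
    have h3 : ∀ n, 2 ≤ n → n + 2 ≤ 2 ^ n := by
      intro n hn
      induction n, hn using Nat.le_induction with
      | base => norm_num
      | succ n hn ih => rw [pow_succ]; omega
    have := h3 _ h2
    rw [pow_succ]
    omega

theorem label_pos (b c : ℕ) : 0 < label b c := by
  unfold label
  split_ifs
  · exact (Nat.nth_mem_of_infinite infinite_not_two_pow c).1
  · positivity

theorem label_lt {b c : ℕ} (hc : c < b + redundancy b) : label b c < 2 ^ redundancy b := by
  unfold label
  split_ifs with h
  · classical
    apply Nat.nth_lt_of_lt_count
    have := count_not_two_pow (redundancy b)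
    have := data_add_redundancy_lt b
    omega
  · exact Nat.pow_lt_pow_right (by norm_num) (by omega)

theorem label_injective (b : ℕ) : Function.Injective (label b) := by
  intro c d h
  unfold label at h
  split_ifs at h with hc hd hd
  · exact Nat.nth_injective infinite_not_two_pow h
  · exact absurd h ((Nat.nth_mem_of_infinite infinite_not_two_pow c).2 _)
  · exact absurd h.symm ((Nat.nth_mem_of_infinite infinite_not_two_pow d).2 _)
  · have := Nat.pow_right_injective (le_refl 2) h
    omega

theorem label_eq_of_parityCheck_eq {b c d : ℕ} (hc : c < b + redundancy b)
    (hd : d < b + redundancy b) (h : ∀ j < redundancy b, parityCheck b j c = parityCheck b j d) :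
    c = d := by
  apply label_injective b
  apply Nat.eq_of_testBit_eq
  intro j
  by_cases hj : j < redundancy b
  · have := h j hj
    unfold parityCheck at this
    cases h1 : (label b c).testBit j <;> cases h2 : (label b d).testBit j <;>
      simp_all
  · have hle : 2 ^ redundancy b ≤ 2 ^ j := Nat.pow_le_pow_right (by norm_num) (by omega)
    rw [Nat.testBit_lt_two_pow ((label_lt hc).trans_le hle),
      Nat.testBit_lt_two_pow ((label_lt hd).trans_le hle)]

theorem exists_parityCheck_ne_zero {b c : ℕ} (hc : c < b + redundancy b) :
    ∃ j < redundancy b, parityCheck b j c ≠ 0 := by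
  obtain ⟨j, hj⟩ := Nat.exists_testBit_of_ne_zero (label_pos b c).ne'
  refine ⟨j, ?_, by simp [parityCheck, hj]⟩
  by_contra h
  have hle : 2 ^ redundancy b ≤ 2 ^ j := Nat.pow_le_pow_right (by norm_num) (by omega)
  rw [Nat.testBit_lt_two_pow ((label_lt hc).trans_le hle)] at hj
  exact absurd hj (by simp)

theorem parityCheck_redundancy (b j i : ℕ) :
    parityCheck b j (b + i) = if i = j then 1 else 0 := by
  simp [parityCheck, label, Nat.testBit_two_pow]

/-- The redundancy columns form an identity matrix, so check `j` sees exactly one parity bit; that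
bit equals the data contribution and cancels it in characteristic two. -/
theorem syndrome_hammingEncode (b : ℕ) (v : ℕ → ZMod 2) {j : ℕ} (hj : j < redundancy b) :
    syndrome b (hammingEncode b v) j = 0 := by
  unfold syndrome
  rw [Finset.sum_range_add]
  have h1 : ∑ x ∈ Finset.range b, parityCheck b j x * hammingEncode b v x =
      ∑ x ∈ Finset.range b, parityCheck b j x * v x :=
    Finset.sum_congr rfl fun x hx => by simp [hammingEncode, Finset.mem_range.1 hx]
  have h2 : ∑ x ∈ Finset.range (redundancy b),
      parityCheck b j (b + x) * hammingEncode b v (b + x) =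
      ∑ x ∈ Finset.range b, parityCheck b j x * v x := by
    simp only [parityCheck_redundancy, ite_mul, one_mul, zero_mul]
    rw [Finset.sum_ite_eq' , if_pos (Finset.mem_range.2 hj)]
    simp [hammingEncode]
  rw [h1, h2]
  exact CharTwo.add_self_eq_zero _

/-- The Hamming decoder recovers the data word from a codeword with at most one error. -/
theorem hammingDecode_eq {b : ℕ} {v w : ℕ → ZMod 2} {c₀ : ℕ}
    (h : ∀ c < b + redundancy b, c ≠ c₀ → w c = hammingEncode b v c) {d : ℕ} (hd : d < b) :
    hammingDecode b w d = v d := by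
  have hd' : d < b + redundancy b := by omega
  have hv : hammingEncode b v d = v d := by simp [hammingEncode, hd]
  by_cases hgood : ∀ c < b + redundancy b, w c = hammingEncode b v c
  · have hs : ∀ j < redundancy b, syndrome b w j = 0 := fun j hj => by
      rw [← syndrome_hammingEncode b v hj]
      exact Finset.sum_congr rfl fun c hc => by rw [hgood c (Finset.mem_range.1 hc)]
    -- A zero syndrome matches no column, as all columns are nonzero, so nothing is flipped.
    obtain ⟨j, hj, hne⟩ := exists_parityCheck_ne_zero hd'
    rw [hammingDecode, if_neg, add_zero, hgood d hd', hv]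
    exact fun H => hne ((H j hj).symm.trans (hs j hj))
  · push Not at hgood
    obtain ⟨c, hc, hne⟩ := hgood
    have hc0 : c = c₀ := by
      by_contra hcc
      exact hne (h c hc hcc)
    subst hc0
    have hflip : w c = hammingEncode b v c + 1 := by
      generalize w c = x at hne ⊢
      generalize hammingEncode b v c = y at hne ⊢
      revert x y; decide
    -- By linearity the syndrome depends only on the error, here the unit vector at `c`; distinct
    -- columns then identify `c`.
    have hs : ∀ j < redundancy b, syndrome b w j = parityCheck b j c := fun j hj => by
      have : syndrome b w j - syndrome b (hammingEncode b v) j = parityCheck b j c := by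
        unfold syndrome
        rw [← Finset.sum_sub_distrib, Finset.sum_eq_single_of_mem c (Finset.mem_range.2 hc)]
        · rw [hflip]; ring
        · intro x hx hxc
          rw [h x (Finset.mem_range.1 hx) hxc, sub_self]
      rwa [syndrome_hammingEncode b v hj, sub_zero] at this
    unfold hammingDecode
    by_cases hdc : d = c
    · subst hdc
      rw [if_pos hs, hflip, hv, add_assoc, CharTwo.add_self_eq_zero, add_zero]
    · rw [if_neg, add_zero, h d hd' hdc, hv]
      intro H
      exact hdc (label_eq_of_parityCheck_eq hc hd' fun j hj => (hs j hj).symm.trans (H j hj)).symm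

/-! ### Block lengths, and dependence on finitely many bits -/

/-- The number of hops of a level-`l` segment of the chain. -/
def hopLen (t : ℕ → ℕ) (l : ℕ) : ℕ := ∏ i ∈ Finset.Icc 1 l, t i

theorem hopLen_zero (t : ℕ → ℕ) : hopLen t 0 = 1 := by simp [hopLen]

theorem hopLen_succ (t : ℕ → ℕ) (l : ℕ) : hopLen t (l + 1) = t (l + 1) * hopLen t l := by
  rw [hopLen, Finset.prod_Icc_succ_top (by omega), mul_comm]; rfl

theorem msgLen_zero (b : ℕ → ℕ) : msgLen b 0 = 1 := by simp [msgLen]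

theorem msgLen_succ (b : ℕ → ℕ) (l : ℕ) : msgLen b (l + 1) = b (l + 1) * msgLen b l := by
  rw [msgLen, Finset.prod_Icc_succ_top (by omega), mul_comm]; rfl

theorem codeLen_zero (b : ℕ → ℕ) : codeLen b 0 = 1 := by simp [codeLen]

theorem codeLen_succ (b : ℕ → ℕ) (l : ℕ) :
    codeLen b (l + 1) = (b (l + 1) + redundancy (b (l + 1))) * codeLen b l := by
  rw [codeLen, Finset.prod_Icc_succ_top (by omega), mul_comm]; rfl

theorem redundancy_pos (b : ℕ) : 0 < redundancy b := by
  unfold redundancy; split_ifs <;> omega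

theorem codeLen_pos (b : ℕ → ℕ) (l : ℕ) : 0 < codeLen b l :=
  Finset.prod_pos fun i _ => by have := redundancy_pos (b i); omega

theorem hopLen_dvd (t : ℕ → ℕ) {l l' : ℕ} (h : l ≤ l') : hopLen t l ∣ hopLen t l' :=
  Finset.prod_dvd_prod_of_subset _ _ _ (Finset.Icc_subset_Icc_right h)

theorem hammingEncode_congr {b : ℕ} {v v' : ℕ → ZMod 2} (h : ∀ d < b, v d = v' d) (c : ℕ) :
    hammingEncode b v c = hammingEncode b v' c := by
  unfold hammingEncode
  split_ifs with hc
  · exact h c hc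
  · exact Finset.sum_congr rfl fun d hd => by rw [h d (Finset.mem_range.1 hd)]

theorem hammingDecode_congr {b : ℕ} {w w' : ℕ → ZMod 2}
    (h : ∀ c < b + redundancy b, w c = w' c) {d : ℕ} (hd : d < b) :
    hammingDecode b w d = hammingDecode b w' d := by
  have hs : syndrome b w = syndrome b w' := funext fun j =>
    Finset.sum_congr rfl fun c hc => by rw [h c (Finset.mem_range.1 hc)]
  rw [hammingDecode, hammingDecode, hs, h d (by omega)]

theorem add_mul_lt_mul {c n x m : ℕ} (hc : c < n) (hx : x < m) : c * m + x < n * m := by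
  calc c * m + x < c * m + m := by omega
    _ = (c + 1) * m := by ring
    _ ≤ n * m := Nat.mul_le_mul_right _ hc

theorem encode_congr (b : ℕ → ℕ) (l : ℕ) {u u' : ℕ → ZMod 2} (h : ∀ x < msgLen b l, u x = u' x)
    {i : ℕ} (hi : i < codeLen b l) : encode b l u i = encode b l u' i := by
  induction l generalizing u u' i with
  | zero =>
    rw [codeLen_zero] at hi
    exact h i (by rwa [msgLen_zero])
  | succ l ih =>
    simp only [encode]
    refine ih (fun x hx => hammingEncode_congr (fun d hd => h _ ?_) _)
      (Nat.mod_lt _ (codeLen_pos b l))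
    rw [msgLen_succ]
    exact add_mul_lt_mul hd hx

theorem decode_congr (b : ℕ → ℕ) (l : ℕ) {y y' : ℕ → ZMod 2}
    (h : ∀ s < codeLen b l, y s = y' s) {i : ℕ} (hi : i < msgLen b l) :
    decode b l y i = decode b l y' i := by
  induction l generalizing y y' i with
  | zero =>
    rw [msgLen_zero] at hi
    exact h i (by rwa [codeLen_zero])
  | succ l ih =>
    rw [msgLen_succ] at hi
    have hpos : 0 < msgLen b l := Nat.pos_of_ne_zero fun h0 => by simp [h0] at hi
    simp only [decode]
    refine hammingDecode_congr (fun c hc => ih (fun s hs => h _ ?_) (Nat.mod_lt _ hpos))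
      ((Nat.div_lt_iff_lt_mul hpos).2 hi)
    rw [codeLen_succ]
    exact add_mul_lt_mul hc hs

/-! ### Levels of the relay nodes -/

theorem two_pow_le_prod {f : ℕ → ℕ} (hf : ∀ i, 1 ≤ i → 2 ≤ f i) (l : ℕ) :
    2 ^ l ≤ ∏ i ∈ Finset.Icc 1 l, f i := by
  calc 2 ^ l = ∏ _i ∈ Finset.Icc 1 l, 2 := by simp
    _ ≤ _ := Finset.prod_le_prod' fun i hi => hf i (Finset.mem_Icc.1 hi).1

theorem lt_hopLen {t : ℕ → ℕ} (ht : ∀ i, 1 ≤ i → 2 ≤ t i) (l : ℕ) : l < hopLen t l :=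
  Nat.lt_two_pow_self.trans_le (two_pow_le_prod ht l)

theorem lt_msgLen {b : ℕ → ℕ} (hb : ∀ i, 1 ≤ i → 2 ≤ b i) (l : ℕ) : l < msgLen b l :=
  Nat.lt_two_pow_self.trans_le (two_pow_le_prod hb l)

theorem hopLen_level_dvd (t : ℕ → ℕ) (j : ℕ) : hopLen t (level t j) ∣ j :=
  Nat.findGreatest_spec (P := fun l => ∏ i ∈ Finset.Icc 1 l, t i ∣ j) (Nat.zero_le j) (by simp)

/-- The search in `level` stops at `j`, which loses nothing since `l < hopLen t l ≤ j`. -/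
theorem le_level {t : ℕ → ℕ} (ht : ∀ i, 1 ≤ i → 2 ≤ t i) {l j : ℕ} (hj : 0 < j)
    (h : hopLen t l ∣ j) : l ≤ level t j :=
  Nat.le_findGreatest ((lt_hopLen ht l).le.trans (Nat.le_of_dvd hj h)) h

/-- The nodes strictly inside a level-`(l + 1)` segment at multiples of `hopLen t l` have
level `l`. -/
theorem level_inner {t : ℕ → ℕ} (ht : ∀ i, 1 ≤ i → 2 ≤ t i) {l a i : ℕ} (hi : 0 < i)
    (hit : i < t (l + 1)) : level t ((a * t (l + 1) + i) * hopLen t l) = l := by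
  have hpos : 0 < hopLen t l := (Nat.zero_le l).trans_lt (lt_hopLen ht l)
  apply le_antisymm
  · by_contra hlt
    push Not at hlt
    have h := (hopLen_dvd t hlt).trans (hopLen_level_dvd t ((a * t (l + 1) + i) * hopLen t l))
    rw [hopLen_succ] at h
    have h2 := Nat.dvd_of_mul_dvd_mul_right hpos h
    have h3 : t (l + 1) ∣ i := (Nat.dvd_add_right (Dvd.intro_left a rfl)).1 h2
    exact absurd (Nat.le_of_dvd hi h3) (by omega)
  · exact le_level ht (Nat.mul_pos (by omega) hpos) (Dvd.intro_left _ rfl)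

/-! ### Propagation of errors -/

/-- The level-`l` blocks (pairs of a segment of the chain and a block of the stream) that make up
the level-`(l + 1)` block `(a, q)`. -/
def subBlocks (b t : ℕ → ℕ) (l a q : ℕ) : Finset (ℕ × ℕ) :=
  Finset.Ico (a * t (l + 1)) ((a + 1) * t (l + 1)) ×ˢ
    Finset.Ico (q * (b (l + 1) + redundancy (b (l + 1))))
      ((q + 1) * (b (l + 1) + redundancy (b (l + 1))))

/-- The flips `f` (indexed by channel and stream position) corrupt block `q` of level `l` in
segment `a` of level `l`: at level `0`, the bit is flipped; at a positive level, at least two of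
the blocks of the next lower level are corrupted. -/
def Corrupt (b t : ℕ → ℕ) (f : ℕ → ℕ → Bool) : ℕ → ℕ → ℕ → Prop
  | 0, a, q => f a q = true
  | l + 1, a, q => ∃ x ∈ subBlocks b t l a q, ∃ y ∈ subBlocks b t l a q,
      x ≠ y ∧ Corrupt b t f l x.1 x.2 ∧ Corrupt b t f l y.1 y.2

/-- `X j` is the stream of bits that node `j` sends, and the first `S` bits of the streams are
meaningful: relay node `j < m` sends the re-encoding of the decoded blocks of its level of the
stream that it receives. -/
def IsRelayed (b t : ℕ → ℕ) (f : ℕ → ℕ → Bool) (m S : ℕ) (X : ℕ → ℕ → ZMod 2) : Prop :=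
  ∀ j, j + 1 < m → ∀ q s, s < codeLen b (level t (j + 1)) →
    (q + 1) * codeLen b (level t (j + 1)) ≤ S →
    X (j + 1) (q * codeLen b (level t (j + 1)) + s) =
      encode b (level t (j + 1))
        (decode b (level t (j + 1)) fun s' =>
          X j (q * codeLen b (level t (j + 1)) + s') +
            flipBit (f j (q * codeLen b (level t (j + 1)) + s'))) s

/-- If the segments from `a₀` on with index less than `a₁` are connected by nodes of level `l`,
and none of them corrupts block `q`, then the message of this block reaches their first nodes. -/
theorem encoded_of_segments {b t : ℕ → ℕ} (ht : ∀ i, 1 ≤ i → 2 ≤ t i) {f : ℕ → ℕ → Bool}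
    {m S : ℕ} {X : ℕ → ℕ → ZMod 2} (hX : IsRelayed b t f m S X) {l a₀ n q : ℕ}
    {u : ℕ → ZMod 2} (hS : (q + 1) * codeLen b l ≤ S)
    (hlev : ∀ i, 0 < i → i < n → (a₀ + i) * hopLen t l < m → level t ((a₀ + i) * hopLen t l) = l)
    (hdec : ∀ i < n, (∀ s < codeLen b l,
        X ((a₀ + i) * hopLen t l) (q * codeLen b l + s) = encode b l u s) →
      ∀ e, (a₀ + i) * hopLen t l ≤ e → e < (a₀ + i + 1) * hopLen t l → e < m →
        ∀ x < msgLen b l,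
          decode b l (fun s => X e (q * codeLen b l + s) + flipBit (f e (q * codeLen b l + s))) x
            = u x)
    (h0 : ∀ s < codeLen b l, X (a₀ * hopLen t l) (q * codeLen b l + s) = encode b l u s)
    (i : ℕ) (hi : i < n) (him : (a₀ + i) * hopLen t l < m) (s : ℕ) (hs : s < codeLen b l) :
    X ((a₀ + i) * hopLen t l) (q * codeLen b l + s) = encode b l u s := by
  induction i generalizing s with
  | zero => exact h0 s hs
  | succ i ih =>
    have hpos : 0 < hopLen t l := (Nat.zero_le l).trans_lt (lt_hopLen ht l)
    have hle : (a₀ + i) * hopLen t l < (a₀ + (i + 1)) * hopLen t l :=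
      Nat.mul_lt_mul_of_pos_right (by omega) hpos
    obtain ⟨j, hj⟩ : ∃ j, (a₀ + (i + 1)) * hopLen t l = j + 1 :=
      ⟨(a₀ + (i + 1)) * hopLen t l - 1, by omega⟩
    have hl := hlev (i + 1) (by omega) hi him
    rw [hj] at him hl hle ⊢
    have hrel := hX j him q s
    rw [hl] at hrel
    rw [hrel hs hS]
    refine encode_congr b l (fun x hx => ?_) hs
    refine hdec i (by omega) (fun s hs => ih (by omega) (by omega) s hs) j (by omega) ?_
      (by omega) x hx
    rw [add_assoc, hj]
    exact Nat.lt_succ_self j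

/-- If block `(a, q)` of level `l` is not corrupted, then the message that the first node of the
segment encodes is decoded correctly from what any node of the segment receives. -/
theorem decode_of_not_corrupt {b t : ℕ → ℕ} (hb : ∀ i, 1 ≤ i → 2 ≤ b i)
    (ht : ∀ i, 1 ≤ i → 2 ≤ t i) {f : ℕ → ℕ → Bool}
    {m S : ℕ} {X : ℕ → ℕ → ZMod 2} (hX : IsRelayed b t f m S X) (l : ℕ) {a q : ℕ}
    (hbad : ¬ Corrupt b t f l a q) {u : ℕ → ZMod 2} (hS : (q + 1) * codeLen b l ≤ S)
    (hu : ∀ s < codeLen b l, X (a * hopLen t l) (q * codeLen b l + s) = encode b l u s)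
    {e : ℕ} (hae : a * hopLen t l ≤ e) (hea : e < (a + 1) * hopLen t l) (hem : e < m)
    {x : ℕ} (hx : x < msgLen b l) :
    decode b l (fun s => X e (q * codeLen b l + s) + flipBit (f e (q * codeLen b l + s))) x
      = u x := by
  induction l generalizing a q u e x with
  | zero =>
    simp only [hopLen_zero, msgLen_zero, codeLen_zero, mul_one, Nat.lt_one_iff] at *
    obtain rfl : e = a := by omega
    subst hx
    simp only [Corrupt, Bool.not_eq_true] at hbad
    simp only [decode, add_zero, hbad, flipBit]
    simpa [encode] using hu 0 rfl
  | succ l ih =>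
    set B := b (l + 1) + redundancy (b (l + 1)) with hB
    have hBpos : 0 < B := by have := redundancy_pos (b (l + 1)); omega
    have hpos : 0 < hopLen t l := (Nat.zero_le l).trans_lt (lt_hopLen ht l)
    have htpos : 0 < t (l + 1) := by have := ht (l + 1) (by omega); omega
    have hmpos : 0 < msgLen b l := (Nat.zero_le l).trans_lt (lt_msgLen hb l)
    have hcode : codeLen b (l + 1) = B * codeLen b l := codeLen_succ b l
    have hidx : ∀ c s, q * codeLen b (l + 1) + (c * codeLen b l + s) =
        (q * B + c) * codeLen b l + s := fun c s => by rw [hcode]; ring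
    set v : ℕ → ℕ → ZMod 2 := fun c x =>
      hammingEncode (b (l + 1)) (fun d => u (d * msgLen b l + x)) c with hv
    have hstart : ∀ c < B, ∀ s < codeLen b l,
        X (a * t (l + 1) * hopLen t l) ((q * B + c) * codeLen b l + s) = encode b l (v c) s := by
      intro c hc s hs
      have h := hu (c * codeLen b l + s) (by rw [hcode]; exact add_mul_lt_mul hc hs)
      rw [hidx, hopLen_succ, ← mul_assoc] at h
      rw [h]
      simp only [encode]
      have h1 : (c * codeLen b l + s) / codeLen b l = c := by
        rw [mul_comm, Nat.mul_add_div (codeLen_pos b l), Nat.div_eq_of_lt hs, add_zero]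
      have h2 : (c * codeLen b l + s) % codeLen b l = s := by
        rw [mul_comm, Nat.mul_add_mod, Nat.mod_eq_of_lt hs]
      rw [h1, h2]
    have hblock : ∀ c < B, (∀ i < t (l + 1), ¬ Corrupt b t f l (a * t (l + 1) + i) (q * B + c)) →
        ∀ x < msgLen b l, decode b l (fun s => X e ((q * B + c) * codeLen b l + s) +
          flipBit (f e ((q * B + c) * codeLen b l + s))) x = v c x := by
      intro c hc hgood x hx
      have hSc : (q * B + c + 1) * codeLen b l ≤ S := by
        refine le_trans ?_ hS
        rw [hcode, ← mul_assoc]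
        refine Nat.mul_le_mul_right _ ?_
        rw [add_mul]
        omega
      -- Node `e` lies in the `i`-th sub-segment. The nodes between sub-segments have level exactly
      -- `l`, so block `c` is relayed intact to the start of that sub-segment, where the induction
      -- hypothesis applies.
      set i := e / hopLen t l - a * t (l + 1) with hi
      have h1 : a * t (l + 1) ≤ e / hopLen t l := by
        rw [Nat.le_div_iff_mul_le hpos, mul_assoc, ← hopLen_succ]
        exact hae
      have h2 : e / hopLen t l < (a + 1) * t (l + 1) := by
        rw [Nat.div_lt_iff_lt_mul hpos, mul_assoc, ← hopLen_succ]
        exact hea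
      have h3 : a * t (l + 1) + i = e / hopLen t l := by omega
      have h4 : i < t (l + 1) := by rw [add_mul] at h2; omega
      have h5 : (a * t (l + 1) + i) * hopLen t l ≤ e := by
        rw [h3]; exact Nat.div_mul_le_self _ _
      have h6 : e < (a * t (l + 1) + i + 1) * hopLen t l := by
        rw [h3, ← Nat.div_lt_iff_lt_mul hpos]; exact Nat.lt_succ_self _
      refine ih (hgood i h4) hSc ?_ h5 h6 hem hx
      exact encoded_of_segments ht hX hSc
        (fun i hi hit _ => level_inner ht hi hit)
        (fun i hi hstart e he he' hem x hx => ih (hgood i hi) hSc hstart he he' hem hx)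
        (hstart c hc) i h4 (by omega)
    -- All corrupted sub-blocks share one stream index `c₀`, since two with different indices would
    -- make the whole block corrupt. The Hamming code tolerates arbitrary damage there.
    obtain ⟨c₀, hc₀⟩ : ∃ c₀, ∀ c < B, c ≠ c₀ →
        ∀ i < t (l + 1), ¬ Corrupt b t f l (a * t (l + 1) + i) (q * B + c) := by
      by_contra hcon
      push Not at hcon
      -- `B` is outside the range, so it excludes no index and yields a first bad one; excluding
      -- that one yields a second.
      obtain ⟨c, hc, -, i, hi, hci⟩ := hcon B
      obtain ⟨c', hc', hne, i', hi', hci'⟩ := hcon c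
      refine hbad ⟨(a * t (l + 1) + i, q * B + c), ?_, (a * t (l + 1) + i', q * B + c'), ?_, ?_,
        hci, hci'⟩
      · simp only [subBlocks, Finset.mem_product, Finset.mem_Ico, add_mul, ← hB]
        omega
      · simp only [subBlocks, Finset.mem_product, Finset.mem_Ico, add_mul, ← hB]
        omega
      · intro h
        have := congrArg Prod.snd h
        simp only at this
        omega
    rw [msgLen_succ] at hx
    have hxd : x / msgLen b l * msgLen b l + x % msgLen b l = x := Nat.div_add_mod' _ _
    simp only [decode]
    rw [hammingDecode_eq (v := fun d => u (d * msgLen b l + x % msgLen b l)) (c₀ := c₀)]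
    · simp only [hxd]
    · intro c hc hcc
      simp only [hidx]
      exact hblock c hc (hc₀ c hc hcc) _ (Nat.mod_lt _ hmpos)
    · exact (Nat.div_lt_iff_lt_mul hmpos).2 hx

/-! ### The streams of bits in the protocol -/

theorem delay_succ (b t : ℕ → ℕ) (j : ℕ) :
    delay b t (j + 1) = delay b t j + codeLen b (level t (j + 1)) :=
  Finset.sum_Icc_succ_top (by omega) _

theorem delay_mono (b t : ℕ → ℕ) : Monotone (delay b t) :=
  monotone_nat_of_le_succ fun j => by rw [delay_succ]; omega

theorem delay_add_lt {b t : ℕ → ℕ} {m k j s : ℕ} (hj : j < m)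
    (hs : s < numBlocks b t m k * codeLen b (topLevel b t m k)) :
    delay b t j + s < transmissionTime b t m k := by
  have := delay_mono b t (show j ≤ m - 1 by omega)
  unfold transmissionTime
  omega

/-- The channel flips, indexed by channel and position in the stream of the sending node. -/
def streamFlip (b t : ℕ → ℕ) (m k : ℕ) (z : Fin m × Fin (transmissionTime b t m k) → Bool)
    (j s : ℕ) : Bool :=
  if h : j < m ∧ delay b t j + s < transmissionTime b t m k then
    z (⟨j, h.1⟩, ⟨delay b t j + s, h.2⟩) else false

/-- The stream of bits that node `j + 1` receives. -/
noncomputable def receivedStream (b t : ℕ → ℕ) (m k : ℕ) (msg : Fin k → ZMod 2)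
    (z : Fin m × Fin (transmissionTime b t m k) → Bool) (j s : ℕ) : ZMod 2 :=
  if h : j < m ∧ delay b t j + s < transmissionTime b t m k then
    (multiBitProtocol b t m k).received msg z j h.1 ⟨delay b t j + s, h.2⟩ else 0

/-- The stream of bits that node `j` sends. -/
noncomputable def sentStream (b t : ℕ → ℕ) (m k : ℕ) (msg : Fin k → ZMod 2)
    (z : Fin m × Fin (transmissionTime b t m k) → Bool) (j s : ℕ) : ZMod 2 :=
  receivedStream b t m k msg z j s + flipBit (streamFlip b t m k z j s)

/-- Block `q` of the message that is padded with zeros. -/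
def messageBlock (b t : ℕ → ℕ) (m k : ℕ) (msg : Fin k → ZMod 2) (q x : ℕ) : ZMod 2 :=
  if h : q * msgLen b (topLevel b t m k) + x < k then
    msg ⟨q * msgLen b (topLevel b t m k) + x, h⟩ else 0

section
variable {b t : ℕ → ℕ} {m k : ℕ} (msg : Fin k → ZMod 2)
  (z : Fin m × Fin (transmissionTime b t m k) → Bool)

theorem sentStream_add_flip (j s : ℕ) :
    sentStream b t m k msg z j s + flipBit (streamFlip b t m k z j s) =
      receivedStream b t m k msg z j s := by
  rw [sentStream, add_assoc, CharTwo.add_self_eq_zero, add_zero]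

theorem mul_add_div_of_lt {n q s : ℕ} (hs : s < n) : (q * n + s) / n = q := by
  rw [mul_comm, Nat.mul_add_div (by omega), Nat.div_eq_of_lt hs, add_zero]

theorem mul_add_mod_of_lt {n q s : ℕ} (hs : s < n) : (q * n + s) % n = s := by
  rw [mul_comm, Nat.mul_add_mod, Nat.mod_eq_of_lt hs]

theorem sentStream_zero (hm : 0 < m) {q s : ℕ} (hq : q < numBlocks b t m k)
    (hs : s < codeLen b (topLevel b t m k)) :
    sentStream b t m k msg z 0 (q * codeLen b (topLevel b t m k) + s) =
      encode b (topLevel b t m k) (messageBlock b t m k msg q) s := by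
  have hlt := delay_add_lt (b := b) (t := t) (k := k) hm (add_mul_lt_mul hq hs)
  have h0 : delay b t 0 = 0 := by simp [delay]
  rw [sentStream, receivedStream, streamFlip, dif_pos ⟨hm, hlt⟩, dif_pos ⟨hm, hlt⟩,
    Protocol.received, add_assoc, CharTwo.add_self_eq_zero, add_zero]
  simp only [multiBitProtocol, h0, zero_add, mul_add_div_of_lt hs, mul_add_mod_of_lt hs]
  rfl

/-- Causality is the point: `delay` grows by one block length at each node, so a node has received a
whole block before it sends the first bit of its re-encoding. The default value `0` in `relay` is
thus never read within a block. -/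
theorem isRelayed_sentStream :
    IsRelayed b t (streamFlip b t m k z) m
      (numBlocks b t m k * codeLen b (topLevel b t m k)) (sentStream b t m k msg z) := by
  intro j hj q s hs hq
  simp only [sentStream_add_flip]
  set N := codeLen b (level t (j + 1)) with hN
  have hqs : ∀ s < N, q * N + s < numBlocks b t m k * codeLen b (topLevel b t m k) :=
    fun s hs => by rw [add_mul] at hq; omega
  have hlt := delay_add_lt (b := b) (t := t) (k := k) hj (hqs s hs)
  rw [sentStream, receivedStream, streamFlip, dif_pos ⟨hj, hlt⟩, dif_pos ⟨hj, hlt⟩,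
    Protocol.received, add_assoc, CharTwo.add_self_eq_zero, add_zero]
  simp only [multiBitProtocol, Nat.add_sub_cancel_left, Nat.add_sub_cancel, ← hN,
    mul_add_div_of_lt hs, mul_add_mod_of_lt hs]
  rw [if_neg (by omega)]
  refine encode_congr b _ (fun x hx => decode_congr b _ (fun s' hs' => ?_) hx) hs
  have hj' : j < m := by omega
  have hlt' := delay_add_lt (b := b) (t := t) (k := k) hj' (hqs s' hs')
  have hr : delay b t j + q * N + s' < delay b t (j + 1) + (q * N + s) := by
    rw [delay_succ, ← hN]
    omega
  rw [dif_pos hr, receivedStream, dif_pos ⟨hj', hlt'⟩]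
  simp only [multiBitProtocol, add_assoc]

/-- No relay exceeds the top level, so divisibility by `hopLen` at that level determines the level
exactly. -/
theorem level_mul_hopLen_topLevel (ht : ∀ i, 1 ≤ i → 2 ≤ t i) {i : ℕ} (hi : 0 < i)
    (him : i * hopLen t (topLevel b t m k) < m) :
    level t (i * hopLen t (topLevel b t m k)) = topLevel b t m k := by
  have hpos : 0 < i * hopLen t (topLevel b t m k) :=
    Nat.mul_pos hi ((Nat.zero_le _).trans_lt (lt_hopLen ht _))
  refine le_antisymm ?_ (le_level ht hpos (Dvd.intro_left _ rfl))
  refine le_trans ?_ (le_max_right _ _)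
  exact Finset.le_sup (f := level t) (Finset.mem_Icc.2 ⟨hpos, by omega⟩)

/-- Top-level segments are joined by relays that decode and re-encode whole top-level blocks, so
each intact segment hands the message on unchanged. The last segment may be cut short by node `m`;
this is harmless because decoding works at every node of an intact segment. -/
theorem estimate_eq_of_not_corrupt (hb : ∀ i, 1 ≤ i → 2 ≤ b i) (ht : ∀ i, 1 ≤ i → 2 ≤ t i)
    (hm : 0 < m)
    (h : ∀ a q, a * hopLen t (topLevel b t m k) < m → q < numBlocks b t m k →
      ¬ Corrupt b t (streamFlip b t m k z) (topLevel b t m k) a q) :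
    (multiBitProtocol b t m k).estimate hm msg z = msg := by
  funext d
  have hN := isRelayed_sentStream msg z
  set M := topLevel b t m k with hM
  have hpos : 0 < hopLen t M := (Nat.zero_le M).trans_lt (lt_hopLen ht M)
  have hmpos : 0 < msgLen b M := (Nat.zero_le M).trans_lt (lt_msgLen hb M)
  have hq : (d : ℕ) / msgLen b M < numBlocks b t m k := by
    rw [Nat.div_lt_iff_lt_mul hmpos, mul_comm]
    exact d.isLt.trans_le (le_smul_ceilDiv hmpos)
  set q := (d : ℕ) / msgLen b M with hqd
  have hS : (q + 1) * codeLen b M ≤ numBlocks b t m k * codeLen b M :=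
    Nat.mul_le_mul_right _ hq
  have hdec : ∀ i < m, (∀ s < codeLen b M, sentStream b t m k msg z ((0 + i) * hopLen t M)
        (q * codeLen b M + s) = encode b M (messageBlock b t m k msg q) s) →
      ∀ e, (0 + i) * hopLen t M ≤ e → e < (0 + i + 1) * hopLen t M → e < m →
        ∀ x < msgLen b M,
          decode b M (fun s => sentStream b t m k msg z e (q * codeLen b M + s) +
            flipBit (streamFlip b t m k z e (q * codeLen b M + s))) x
            = messageBlock b t m k msg q x := fun i _ hX e he he' hem x hx =>
    decode_of_not_corrupt hb ht hN M (h _ q (by omega) hq) hS hX he he' hem hx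
  have hi : (m - 1) / hopLen t M < m := (Nat.div_le_self _ _).trans_lt (by omega)
  have hle : (0 + (m - 1) / hopLen t M) * hopLen t M ≤ m - 1 := by
    rw [zero_add]; exact Nat.div_mul_le_self _ _
  have hlast := encoded_of_segments ht hN (a₀ := 0) (n := m) (q := q) hS
    (fun i hi _ him => by
      rw [zero_add] at him ⊢
      exact level_mul_hopLen_topLevel ht hi him)
    hdec (fun s hs => by rw [zero_mul]; exact sentStream_zero msg z hm hq hs)
    ((m - 1) / hopLen t M) hi (by omega)
  have hfin := hdec _ hi hlast (m - 1) hle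
    (by rw [zero_add, ← Nat.div_lt_iff_lt_mul hpos]; exact Nat.lt_succ_self _) (by omega)
    ((d : ℕ) % msgLen b M) (Nat.mod_lt _ hmpos)
  have hdd : q * msgLen b M + (d : ℕ) % msgLen b M = d := Nat.div_add_mod' _ _
  have hmsg : messageBlock b t m k msg q ((d : ℕ) % msgLen b M) = msg d := by
    unfold messageBlock
    rw [← hM]
    simp only [hdd, d.isLt, dif_pos]
  rw [← hmsg, ← hfin]
  simp only [sentStream_add_flip]
  simp only [Protocol.estimate, multiBitProtocol, ← hM]
  refine decode_congr b M (fun s hs => ?_) (Nat.mod_lt _ hmpos)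
  have hm1 : m - 1 < m := by omega
  have hlt := delay_add_lt (b := b) (t := t) (k := k) hm1 (add_mul_lt_mul hq hs)
  rw [dif_pos (by rw [add_assoc]; exact hlt), receivedStream, dif_pos ⟨hm1, hlt⟩]
  simp only [multiBitProtocol, add_assoc, hqd, ← hM]

end

/-! ### The probability of a corrupted block -/

/-- The minimal sets of channel uses whose flips corrupt block `q` of level `l` in segment `a`. -/
def corruptingSets (b t : ℕ → ℕ) : ℕ → ℕ → ℕ → Finset (Finset (ℕ × ℕ))
  | 0, a, q => {{(a, q)}}
  | l + 1, a, q => (subBlocks b t l a q).offDiag.biUnion fun p =>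
      Finset.image₂ (· ∪ ·) (corruptingSets b t l p.1.1 p.1.2) (corruptingSets b t l p.2.1 p.2.2)

/-- A bound for the number of minimal sets of channel uses that corrupt a level-`l` block. -/
def corruptCount (b t : ℕ → ℕ) : ℕ → ℕ
  | 0 => 1
  | l + 1 => (t (l + 1) * (b (l + 1) + redundancy (b (l + 1)))) ^ 2 * corruptCount b t l ^ 2

theorem card_subBlocks (b t : ℕ → ℕ) (l a q : ℕ) :
    (subBlocks b t l a q).card = t (l + 1) * (b (l + 1) + redundancy (b (l + 1))) := by
  simp [subBlocks, add_mul]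

theorem card_corruptingSets_le (b t : ℕ → ℕ) (l a q : ℕ) :
    (corruptingSets b t l a q).card ≤ corruptCount b t l := by
  induction l generalizing a q with
  | zero => simp [corruptingSets, corruptCount]
  | succ l ih =>
    refine (Finset.card_biUnion_le_card_mul _ _ (corruptCount b t l ^ 2) fun p _ => ?_).trans ?_
    · rw [sq]
      exact (Finset.card_image₂_le _ _ _).trans (Nat.mul_le_mul (ih _ _) (ih _ _))
    · refine Nat.mul_le_mul_right _ ?_
      rw [Finset.offDiag_card, card_subBlocks, sq]
      exact Nat.sub_le _ _

theorem exists_corruptingSet {b t : ℕ → ℕ} {f : ℕ → ℕ → Bool} {l a q : ℕ}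
    (h : Corrupt b t f l a q) :
    ∃ s ∈ corruptingSets b t l a q, ∀ x ∈ s, f x.1 x.2 = true := by
  induction l generalizing a q with
  | zero => exact ⟨{(a, q)}, by simp [corruptingSets], by simpa [Corrupt] using h⟩
  | succ l ih =>
    obtain ⟨x, hx, y, hy, hxy, hcx, hcy⟩ := h
    obtain ⟨s, hs, hfs⟩ := ih hcx
    obtain ⟨s', hs', hfs'⟩ := ih hcy
    refine ⟨s ∪ s', Finset.mem_biUnion.2 ⟨(x, y), Finset.mem_offDiag.2 ⟨hx, hy, hxy⟩,
      Finset.mem_image₂_of_mem hs hs'⟩, fun w hw => ?_⟩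
    rcases Finset.mem_union.1 hw with hw | hw
    · exact hfs w hw
    · exact hfs' w hw

/-- A corrupting set stays inside the rectangle of its block. Hence sets belonging to different
blocks of the same level are disjoint, and cardinalities double from level to level. -/
theorem div_eq_of_mem_corruptingSet {b t : ℕ → ℕ} {l a q : ℕ} {s : Finset (ℕ × ℕ)}
    (hs : s ∈ corruptingSets b t l a q) {x : ℕ × ℕ} (hx : x ∈ s) :
    x.1 / hopLen t l = a ∧ x.2 / codeLen b l = q := by
  induction l generalizing a q s with
  | zero =>
    simp only [corruptingSets, Finset.mem_singleton] at hs
    subst hs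
    rw [Finset.mem_singleton] at hx
    simp [hx, hopLen_zero, codeLen_zero]
  | succ l ih =>
    simp only [corruptingSets, Finset.mem_biUnion, Finset.mem_image₂, Finset.mem_offDiag] at hs
    obtain ⟨p, ⟨hp1, hp2, -⟩, s1, hs1, s2, hs2, rfl⟩ := hs
    have key : ∀ y ∈ subBlocks b t l a q, x.1 / hopLen t l = y.1 ∧ x.2 / codeLen b l = y.2 →
        x.1 / hopLen t (l + 1) = a ∧ x.2 / codeLen b (l + 1) = q := by
      rintro y hy ⟨h1, h2⟩
      rw [subBlocks, Finset.mem_product, Finset.mem_Ico, Finset.mem_Ico] at hy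
      rw [hopLen_succ, codeLen_succ, mul_comm, ← Nat.div_div_eq_div_mul, h1, mul_comm,
        ← Nat.div_div_eq_div_mul, h2]
      exact ⟨Nat.div_eq_of_lt_le hy.1.1 hy.1.2, Nat.div_eq_of_lt_le hy.2.1 hy.2.2⟩
    rcases Finset.mem_union.1 hx with hx | hx
    · exact key _ hp1 (ih hs1 hx)
    · exact key _ hp2 (ih hs2 hx)

theorem card_of_mem_corruptingSets {b t : ℕ → ℕ} {l a q : ℕ} {s : Finset (ℕ × ℕ)}
    (hs : s ∈ corruptingSets b t l a q) : s.card = 2 ^ l := by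
  induction l generalizing a q s with
  | zero =>
    simp only [corruptingSets, Finset.mem_singleton] at hs
    simp [hs]
  | succ l ih =>
    simp only [corruptingSets, Finset.mem_biUnion, Finset.mem_image₂, Finset.mem_offDiag] at hs
    obtain ⟨p, ⟨-, -, hne⟩, s1, hs1, s2, hs2, rfl⟩ := hs
    rw [Finset.card_union_of_disjoint, ih hs1, ih hs2, pow_succ, mul_two]
    refine Finset.disjoint_left.2 fun x hx1 hx2 => hne ?_
    obtain ⟨h1, h2⟩ := div_eq_of_mem_corruptingSet hs1 hx1
    obtain ⟨h3, h4⟩ := div_eq_of_mem_corruptingSet hs2 hx2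
    exact Prod.ext (h1.symm.trans h3) (h2.symm.trans h4)

instance (m n : ℕ) (p : unitInterval) : IsProbabilityMeasure (noise m n p) := by
  unfold noise; infer_instance

/-- The probability that all channel uses in a given set have their bits flipped. -/
theorem noise_forall_flip {m n : ℕ} (p : unitInterval) (s : Finset (Fin m × Fin n)) :
    (noise m n p).real {z | ∀ x ∈ s, z x = true} = (p : ℝ) ^ s.card := by
  have hset : {z : Fin m × Fin n → Bool | ∀ x ∈ s, z x = true} =
      Set.pi Set.univ fun x => if x ∈ s then {true} else Set.univ := by
    ext z
    simp only [Set.mem_ofPred_eq, Set.mem_pi, Set.mem_univ, true_implies]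
    refine forall_congr' fun x => ?_
    split_ifs with h <;> simp [h]
  rw [hset, noise, measureReal_def, Measure.pi_pi, ENNReal.toReal_prod, ← Finset.prod_const]
  rw [← Finset.prod_subset (Finset.subset_univ s)]
  · refine Finset.prod_congr rfl fun x hx => ?_
    rw [if_pos hx]
    rw [← measureReal_def,
      bernoulliMeasure_real_apply_of_mem_of_notMem p (by simp) (by simp) (by simp)]
  · intro x _ hx
    simp [hx]

/-- Shifting by the delay of the channel maps stream positions injectively to channel uses. A
position outside the time range never counts as flipped, so the event is then empty. -/
theorem noise_streamFlip_le (b t : ℕ → ℕ) (m k : ℕ) (p : unitInterval) (s : Finset (ℕ × ℕ)) :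
    (noise m (transmissionTime b t m k) p).real
      {z | ∀ x ∈ s, streamFlip b t m k z x.1 x.2 = true} ≤ (p : ℝ) ^ s.card := by
  by_cases hs : ∀ x ∈ s, x.1 < m ∧ delay b t x.1 + x.2 < transmissionTime b t m k
  · let g : s → Fin m × Fin (transmissionTime b t m k) := fun x =>
      (⟨x.1.1, (hs _ x.2).1⟩, ⟨delay b t x.1.1 + x.1.2, (hs _ x.2).2⟩)
    have hg : Function.Injective g := by
      rintro ⟨⟨x1, x2⟩, hx⟩ ⟨⟨y1, y2⟩, hy⟩ h
      simp only [g, Prod.mk.injEq, Fin.mk.injEq] at h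
      obtain ⟨rfl, h2⟩ := h
      obtain rfl : x2 = y2 := by omega
      rfl
    have hcard : (s.attach.image g).card = s.card := by
      rw [Finset.card_image_of_injective _ hg, Finset.card_attach]
    rw [← hcard, ← noise_forall_flip]
    refine measureReal_mono fun z hz y hy => ?_
    obtain ⟨x, -, rfl⟩ := Finset.mem_image.1 hy
    have := hz x.1 x.2
    rwa [streamFlip, dif_pos (hs _ x.2)] at this
  · push Not at hs
    obtain ⟨x, hx, hlt⟩ := hs
    have : {z | ∀ x ∈ s, streamFlip b t m k z x.1 x.2 = true} = ∅ := by
      refine Set.eq_empty_of_forall_notMem fun z hz => ?_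
      have := hz x hx
      rw [streamFlip, dif_neg (by rintro ⟨h1, h2⟩; exact absurd (hlt h1) (by omega))] at this
      exact absurd this (by simp)
    rw [this, measureReal_empty]
    exact pow_nonneg p.2.1 _

theorem noise_corrupt_le (b t : ℕ → ℕ) (m k : ℕ) (p : unitInterval) (l a q : ℕ) :
    (noise m (transmissionTime b t m k) p).real
      {z | Corrupt b t (streamFlip b t m k z) l a q} ≤ corruptCount b t l * (p : ℝ) ^ 2 ^ l := by
  calc _ ≤ (noise m (transmissionTime b t m k) p).real
        (⋃ s ∈ corruptingSets b t l a q, {z | ∀ x ∈ s, streamFlip b t m k z x.1 x.2 = true}) := by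
        refine measureReal_mono (fun z hz => ?_) (measure_ne_top _ _)
        obtain ⟨s, hs, h⟩ := exists_corruptingSet hz
        exact Set.mem_biUnion hs h
    _ ≤ ∑ s ∈ corruptingSets b t l a q, (noise m (transmissionTime b t m k) p).real
        {z | ∀ x ∈ s, streamFlip b t m k z x.1 x.2 = true} := measureReal_biUnion_finset_le _ _
    _ ≤ ∑ s ∈ corruptingSets b t l a q, (p : ℝ) ^ 2 ^ l := by
        refine Finset.sum_le_sum fun s hs => ?_
        rw [← card_of_mem_corruptingSets hs]
        exact noise_streamFlip_le b t m k p s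
    _ ≤ _ := by
        rw [Finset.sum_const, nsmul_eq_mul]
        exact mul_le_mul_of_nonneg_right (by exact_mod_cast card_corruptingSets_le b t l a q)
          (pow_nonneg p.2.1 _)

/-- A union bound for the error probability: the top-level segments are the first `A` ones. -/
theorem errorProb_le {b t : ℕ → ℕ} (hb : ∀ i, 1 ≤ i → 2 ≤ b i) (ht : ∀ i, 1 ≤ i → 2 ≤ t i)
    {m k A : ℕ} (hm : 0 < m) (hA : m ≤ A * hopLen t (topLevel b t m k)) (p : unitInterval)
    (msg : Fin k → ZMod 2) :
    (multiBitProtocol b t m k).errorProb hm p msg ≤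
      A * numBlocks b t m k *
        (corruptCount b t (topLevel b t m k) * (p : ℝ) ^ 2 ^ topLevel b t m k) := by
  calc _ ≤ (noise m (transmissionTime b t m k) p).real
        (⋃ x ∈ Finset.range A ×ˢ Finset.range (numBlocks b t m k),
          {z | Corrupt b t (streamFlip b t m k z) (topLevel b t m k) x.1 x.2}) := by
        refine measureReal_mono (fun z hz => ?_) (measure_ne_top _ _)
        by_contra hcon
        refine hz (estimate_eq_of_not_corrupt msg z hb ht hm fun a q ha hq hc => hcon ?_)
        refine Set.mem_biUnion (x := (a, q)) ?_ hc
        simp only [Finset.coe_product, Finset.coe_range, Set.mem_prod, Set.mem_Iio]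
        exact ⟨Nat.lt_of_mul_lt_mul_right (ha.trans_le hA), hq⟩
    _ ≤ ∑ x ∈ Finset.range A ×ˢ Finset.range (numBlocks b t m k),
        (noise m (transmissionTime b t m k) p).real
          {z | Corrupt b t (streamFlip b t m k z) (topLevel b t m k) x.1 x.2} :=
        measureReal_biUnion_finset_le _ _
    _ ≤ ∑ _x ∈ Finset.range A ×ˢ Finset.range (numBlocks b t m k),
        (corruptCount b t (topLevel b t m k) * (p : ℝ) ^ 2 ^ topLevel b t m k) :=
        Finset.sum_le_sum fun x _ => noise_corrupt_le b t m k p _ _ _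
    _ = _ := by simp

/-! ### The parameters of the protocol -/

theorem two_le_bSeq (i : ℕ) (hi : 1 ≤ i) : 2 ≤ bSeq i := by
  have : 3 ^ 2 ≤ (i + 2) ^ 2 := Nat.pow_le_pow_left (by omega) 2
  unfold bSeq
  omega

theorem two_le_tSeq (i : ℕ) (hi : 1 ≤ i) : 2 ≤ tSeq i := by
  have : 3 ^ 2 ≤ (i + 2) ^ 2 := Nat.pow_le_pow_left (by omega) 2
  unfold tSeq
  omega

theorem clog_lt_self {b : ℕ} (hb : 1 ≤ b) : Nat.clog 2 b < b := by
  have h : b ≤ 2 ^ (b - 1) := by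
    have := Nat.lt_two_pow_self (n := b - 1)
    omega
  have := Nat.clog_le_of_le_pow h
  omega

/-- The ratio `5 / 9` is attained at `i = 1`, where `2 + 3` blocks meet `9` hops. For larger `i` the
redundancy is at most `bSeq i`, which gives the better ratio `1 / 2`. -/
theorem bSeq_add_redundancy_le (i : ℕ) (hi : 1 ≤ i) :
    9 * (bSeq i + redundancy (bSeq i)) ≤ 5 * tSeq i := by
  rcases hi.eq_or_lt with rfl | hi
  · have h1 : Nat.clog 2 2 = 1 := Nat.clog_eq_one le_rfl le_rfl
    simp [bSeq, tSeq, redundancy, h1]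
  · have h4 : 4 ^ 2 ≤ (i + 2) ^ 2 := Nat.pow_le_pow_left (by omega) 2
    have hb : 4 ≤ bSeq i := by unfold bSeq; omega
    have h := clog_lt_self (b := bSeq i) (by omega)
    have hb' : 4 * bSeq i ≤ tSeq i := by unfold bSeq tSeq; omega
    rw [redundancy, if_neg (by omega)]
    omega

theorem corruptCount_mul_pow_le {p : ℝ} (hp0 : 0 ≤ p) (hp : p ≤ (3 : ℝ) ^ (-8 : ℤ) / 4) (l : ℕ) :
    corruptCount bSeq tSeq l * p ^ 2 ^ l ≤ 1 / (4 * ((l : ℝ) + 3) ^ 8) := by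
  induction l with
  | zero =>
    simp only [corruptCount, Nat.cast_one, one_mul, pow_zero, pow_one, Nat.cast_zero, zero_add]
    refine hp.trans (le_of_eq ?_)
    norm_num [zpow_neg]
  | succ l ih =>
    set s : ℝ := (l : ℝ) + 3 with hs
    have hs3 : 3 ≤ s := by rw [hs]; have := Nat.cast_nonneg (α := ℝ) l; linarith
    have hN : ((tSeq (l + 1) * (bSeq (l + 1) + redundancy (bSeq (l + 1))) : ℕ) : ℝ) ≤
        5 / 9 * s ^ 4 := by
      have h := bSeq_add_redundancy_le (l + 1) (by omega)
      have h2 : tSeq (l + 1) * (9 * (bSeq (l + 1) + redundancy (bSeq (l + 1)))) ≤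
          tSeq (l + 1) * (5 * tSeq (l + 1)) := Nat.mul_le_mul_left _ h
      have h3 : ((tSeq (l + 1) * (9 * (bSeq (l + 1) + redundancy (bSeq (l + 1)))) : ℕ) : ℝ) ≤
          ((tSeq (l + 1) * (5 * tSeq (l + 1)) : ℕ) : ℝ) := by exact_mod_cast h2
      have ht : (tSeq (l + 1) : ℝ) = s ^ 2 := by rw [hs, tSeq]; push_cast; ring
      push_cast at h3 ⊢
      rw [ht] at h3 ⊢
      nlinarith
    -- This uses `s ≥ 3`. The induction closes because `100 * (4/3)^8 < 999`, below `1296`.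
    have hpow : (s + 1) ^ 8 ≤ (4 / 3 * s) ^ 8 :=
      pow_le_pow_left₀ (by linarith) (by linarith) 8
    have hs8 : 0 < s ^ 8 := by positivity
    calc (corruptCount bSeq tSeq (l + 1) : ℝ) * p ^ 2 ^ (l + 1)
        = ((tSeq (l + 1) * (bSeq (l + 1) + redundancy (bSeq (l + 1))) : ℕ) : ℝ) ^ 2 *
          (corruptCount bSeq tSeq l * p ^ 2 ^ l) ^ 2 := by
          rw [corruptCount, pow_succ 2 l, pow_mul]
          push_cast
          ring
      _ ≤ (5 / 9 * s ^ 4) ^ 2 * (1 / (4 * s ^ 8)) ^ 2 := by gcongr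
      _ = 25 / (1296 * s ^ 8) := by field_simp; norm_num
      _ ≤ 1 / (4 * (s + 1) ^ 8) := by
          rw [div_le_div_iff₀ (by positivity) (by positivity)]
          rw [mul_pow] at hpow
          norm_num at hpow ⊢
          linarith
      _ = _ := by rw [hs]; push_cast; ring

/-- Otherwise the node numbered `hopLen t (M + 1)`, with `M` the top level, would be a relay of
level above `M`. -/
theorem le_hopLen_topLevel_succ {b t : ℕ → ℕ} (ht : ∀ i, 1 ≤ i → 2 ≤ t i) (m k : ℕ) :
    m ≤ hopLen t (topLevel b t m k + 1) := by
  by_contra hlt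
  push Not at hlt
  have hpos := (Nat.zero_le _).trans_lt (lt_hopLen ht (topLevel b t m k + 1))
  have h1 : topLevel b t m k + 1 ≤ level t (hopLen t (topLevel b t m k + 1)) :=
    le_level ht hpos dvd_rfl
  have h2 : level t (hopLen t (topLevel b t m k + 1)) ≤ maxRelayLevel t m :=
    Finset.le_sup (f := level t) (Finset.mem_Icc.2 ⟨hpos, by omega⟩)
  have h3 : maxRelayLevel t m ≤ topLevel b t m k := le_max_right _ _
  omega

theorem lt_msgLen_msgLevel_succ {b : ℕ → ℕ} (hb : ∀ i, 1 ≤ i → 2 ≤ b i) (k : ℕ) :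
    k < msgLen b (msgLevel b k + 1) := by
  by_contra hlt
  push Not at hlt
  have h1 : msgLevel b k + 1 ≤ msgLevel b k :=
    Nat.le_findGreatest ((lt_msgLen hb _).le.trans hlt) hlt
  omega

theorem msgLen_mono {b : ℕ → ℕ} (hb : ∀ i, 1 ≤ i → 2 ≤ b i) : Monotone (msgLen b) :=
  monotone_nat_of_le_succ fun l => by
    rw [msgLen_succ]
    exact Nat.le_mul_of_pos_left _ (by have := hb (l + 1) (by omega); omega)

theorem hopLen_mono {t : ℕ → ℕ} (ht : ∀ i, 1 ≤ i → 2 ≤ t i) : Monotone (hopLen t) :=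
  monotone_nat_of_le_succ fun l => by
    rw [hopLen_succ]
    exact Nat.le_mul_of_pos_left _ (by have := ht (l + 1) (by omega); omega)

theorem numBlocks_le {b t : ℕ → ℕ} (hb : ∀ i, 1 ≤ i → 2 ≤ b i) (m k : ℕ) :
    numBlocks b t m k ≤ b (topLevel b t m k + 1) := by
  have hpos : 0 < msgLen b (topLevel b t m k) := (Nat.zero_le _).trans_lt (lt_msgLen hb _)
  rw [numBlocks, ceilDiv_le_iff_le_smul hpos, smul_eq_mul, mul_comm, ← msgLen_succ]
  exact (lt_msgLen_msgLevel_succ hb k).le.trans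
    (msgLen_mono hb (Nat.succ_le_succ (le_max_left _ _)))

theorem errorProb_multiBitProtocol_le {p : unitInterval} (hp : (p : ℝ) ≤ (3 : ℝ) ^ (-8 : ℤ) / 4)
    {m k : ℕ} (hm : 0 < m) (msg : Fin k → ZMod 2) :
    (multiBitProtocol bSeq tSeq m k).errorProb hm p msg ≤
      1 / ((topLevel bSeq tSeq m k : ℝ) + 3) := by
  set M := topLevel bSeq tSeq m k with hM
  have h := errorProb_le (A := tSeq (M + 1)) two_le_bSeq two_le_tSeq hm
    (by rw [← hM, ← hopLen_succ, hM]; exact le_hopLen_topLevel_succ two_le_tSeq m k) p msg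
  rw [← hM] at h
  refine h.trans ?_
  set s : ℝ := (M : ℝ) + 3 with hs
  have hs3 : 3 ≤ s := by rw [hs]; have := Nat.cast_nonneg (α := ℝ) M; linarith
  have ht : (tSeq (M + 1) : ℝ) = s ^ 2 := by rw [hs, tSeq]; push_cast; ring
  have hn : (numBlocks bSeq tSeq m k : ℝ) ≤ s ^ 2 := by
    rw [← ht]
    have h1 : numBlocks bSeq tSeq m k ≤ bSeq (M + 1) := numBlocks_le two_le_bSeq m k
    have h2 : bSeq (M + 1) ≤ tSeq (M + 1) := Nat.div_le_self _ _
    exact_mod_cast h1.trans h2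
  have hc := corruptCount_mul_pow_le p.2.1 hp M
  rw [ht]
  -- The factors bound the segments, the message blocks, and the corruption probability of one block
  -- in one segment.
  calc _ ≤ s ^ 2 * s ^ 2 * (1 / (4 * s ^ 8)) := by
        refine mul_le_mul (by gcongr) hc ?_ (by positivity)
        exact mul_nonneg (by positivity) (pow_nonneg p.2.1 _)
    _ = 1 / (4 * s ^ 4) := by field_simp
    _ ≤ 1 / s := by
        apply one_div_le_one_div_of_le (by linarith)
        have : s ^ 1 ≤ s ^ 4 := pow_le_pow_right₀ (by linarith) (by norm_num)
        linarith

/-! ### The transmission time -/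

theorem codeLen_le_hopLen (l : ℕ) :
    (codeLen bSeq l : ℝ) ≤ (5 / 9) ^ l * hopLen tSeq l := by
  induction l with
  | zero => simp [codeLen_zero, hopLen_zero]
  | succ l ih =>
    have h : (9 : ℝ) * ((bSeq (l + 1) + redundancy (bSeq (l + 1)) : ℕ) : ℝ) ≤
        5 * (tSeq (l + 1) : ℝ) := by exact_mod_cast bSeq_add_redundancy_le (l + 1) (by omega)
    rw [codeLen_succ, hopLen_succ, Nat.cast_mul, Nat.cast_mul]
    calc _ ≤ (5 / 9 * (tSeq (l + 1) : ℝ)) * ((5 / 9) ^ l * hopLen tSeq l) :=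
          mul_le_mul (by linarith) ih (by positivity) (by positivity)
      _ = _ := by ring

theorem level_le (t : ℕ → ℕ) (j : ℕ) : level t j ≤ j := Nat.findGreatest_le j

theorem delay_le (n : ℕ) : (delay bSeq tSeq n : ℝ) ≤ 9 / 4 * n := by
  have h1 : delay bSeq tSeq n ≤
      ∑ l ∈ Finset.range (n + 1), codeLen bSeq l * (n / hopLen tSeq l) := by
    calc delay bSeq tSeq n
        -- Each node is charged for every `l` with `hopLen tSeq l ∣ j`, not only for its level; this
        -- overcount makes the sum over `j` a count of multiples.
        ≤ ∑ j ∈ Finset.Icc 1 n, ∑ l ∈ Finset.range (n + 1),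
          if hopLen tSeq l ∣ j then codeLen bSeq l else 0 := by
          refine Finset.sum_le_sum fun j hj => ?_
          have hl : level tSeq j ∈ Finset.range (n + 1) := by
            have := level_le tSeq j
            rw [Finset.mem_Icc] at hj
            rw [Finset.mem_range]
            omega
          refine le_trans ?_ (Finset.single_le_sum (fun l _ => Nat.zero_le _) hl)
          rw [if_pos (hopLen_level_dvd tSeq j)]
      _ = _ := by
          rw [Finset.sum_comm]
          refine Finset.sum_congr rfl fun l _ => ?_
          rw [← Finset.sum_filter, Finset.sum_const, smul_eq_mul, mul_comm,
            ← Nat.Ioc_filter_dvd_card_eq_div]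
          rfl
  calc (delay bSeq tSeq n : ℝ)
      ≤ ∑ l ∈ Finset.range (n + 1), (codeLen bSeq l : ℝ) * ((n / hopLen tSeq l : ℕ) : ℝ) := by
        exact_mod_cast h1
    _ ≤ ∑ l ∈ Finset.range (n + 1), (5 / 9 : ℝ) ^ l * n := by
        refine Finset.sum_le_sum fun l _ => ?_
        have hpos : (0 : ℝ) < hopLen tSeq l := by
          exact_mod_cast (Nat.zero_le l).trans_lt (lt_hopLen two_le_tSeq l)
        calc _ ≤ ((5 / 9) ^ l * hopLen tSeq l) * ((n : ℝ) / hopLen tSeq l) :=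
              mul_le_mul (codeLen_le_hopLen l) Nat.cast_div_le (by positivity) (by positivity)
          _ = _ := by field_simp
    _ ≤ 9 / 4 * n := by
        rw [← Finset.sum_mul]
        refine mul_le_mul_of_nonneg_right ?_ (by positivity)
        have h := (summable_geometric_of_lt_one (r := (5 / 9 : ℝ)) (by norm_num)
          (by norm_num)).sum_le_tsum (Finset.range (n + 1)) (fun i _ => by positivity)
        rw [tsum_geometric_of_lt_one (by norm_num) (by norm_num)] at h
        norm_num at h ⊢
        exact h

/-- The redundancy is only logarithmic; a square-root bound is enough, since dividing by the
quadratic `bSeq i` leaves the summable exponent `-3/2`. From `log x ≤ 2 * x ^ (1/2)` and `log 2 ≥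
1/2` the logarithm contributes `8`, and the additive `2` the rest. -/
theorem redundancy_bSeq_le (i : ℕ) :
    (redundancy (bSeq i) : ℝ) ≤ 10 * ((i : ℝ) + 2) ^ (1 / 2 : ℝ) := by
  have h1 : redundancy (bSeq i) ≤ Nat.clog 2 (bSeq i) + 2 := by
    unfold redundancy; split_ifs <;> omega
  have hb1 : 1 ≤ bSeq i := by
    have : 2 ^ 2 ≤ (i + 2) ^ 2 := Nat.pow_le_pow_left (by omega) 2
    unfold bSeq
    omega
  have h2 : 2 ^ Nat.clog 2 (bSeq i) ≤ (i + 2) ^ 2 := by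
    have hb2 : 4 * bSeq i ≤ (i + 2) ^ 2 := by unfold bSeq; omega
    rcases Nat.eq_zero_or_pos (Nat.clog 2 (bSeq i)) with h0 | h0
    · rw [h0]; omega
    · have h3 : 2 ^ (Nat.clog 2 (bSeq i) - 1) < bSeq i := by
        rw [← Nat.lt_clog_iff_pow_lt (by norm_num)]; omega
      obtain ⟨c, hc⟩ : ∃ c, Nat.clog 2 (bSeq i) = c + 1 := ⟨_, (Nat.succ_pred_eq_of_pos h0).symm⟩
      rw [hc] at h3 ⊢
      rw [Nat.add_sub_cancel] at h3
      rw [pow_succ]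
      omega
  have h3 : (Nat.clog 2 (bSeq i) : ℝ) * Real.log 2 ≤ 2 * Real.log ((i : ℝ) + 2) := by
    have h : ((2 : ℝ)) ^ Nat.clog 2 (bSeq i) ≤ ((i : ℝ) + 2) ^ 2 := by exact_mod_cast h2
    have := Real.log_le_log (by positivity) h
    rw [Real.log_pow, Real.log_pow] at this
    exact_mod_cast this
  have hi : (1 : ℝ) ≤ (i : ℝ) + 2 := by have := Nat.cast_nonneg (α := ℝ) i; linarith
  have h4 := Real.log_le_rpow_div (x := (i : ℝ) + 2) (ε := 1 / 2) (by positivity) (by norm_num)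
  have h5 : 1 ≤ ((i : ℝ) + 2) ^ (1 / 2 : ℝ) := Real.one_le_rpow hi (by norm_num)
  have h6 : (1 / 2 : ℝ) ≤ Real.log 2 := by have := Real.log_two_gt_d9; linarith
  have h7 : (redundancy (bSeq i) : ℝ) ≤ Nat.clog 2 (bSeq i) + 2 := by exact_mod_cast h1
  have h8 : (Nat.clog 2 (bSeq i) : ℝ) * (1 / 2) ≤ Nat.clog 2 (bSeq i) * Real.log 2 := by gcongr
  have h9 : ((i : ℝ) + 2) ^ (1 / 2 : ℝ) / (1 / 2) = 2 * ((i : ℝ) + 2) ^ (1 / 2 : ℝ) := by ring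
  linarith

theorem redundancy_div_bSeq_le (i : ℕ) (hi : 1 ≤ i) :
    (redundancy (bSeq i) : ℝ) / bSeq i ≤ 60 * ((i : ℝ) + 2) ^ (-(3 / 2) : ℝ) := by
  have hi' : (1 : ℝ) ≤ i := by exact_mod_cast hi
  set s : ℝ := (i : ℝ) + 2 with hs
  have hs0 : 0 < s := by linarith
  -- Rounding down gives `bSeq i ≥ (s ^ 2 - 3) / 4`, which is at least `s ^ 2 / 6` exactly when `s ≥
  -- 3`.
  have hb : s ^ 2 / 6 ≤ bSeq i := by
    have h : (i + 2) ^ 2 ≤ 4 * bSeq i + 3 := by unfold bSeq; omega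
    have h' : s ^ 2 ≤ 4 * (bSeq i : ℝ) + 3 := by rw [hs]; exact_mod_cast h
    nlinarith
  calc _ ≤ (10 * s ^ (1 / 2 : ℝ)) / (s ^ 2 / 6) :=
        div_le_div₀ (by positivity) (redundancy_bSeq_le i) (by positivity) hb
    _ = 60 * (s ^ (1 / 2 : ℝ) / s ^ (2 : ℝ)) := by
        rw [Real.rpow_two]
        field_simp
        norm_num
    _ = _ := by rw [← Real.rpow_sub hs0]; norm_num

theorem summable_redundancy_div_bSeq :
    Summable fun i : ℕ => 60 * ((i : ℝ) + 2) ^ (-(3 / 2) : ℝ) := by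
  have h := (summable_nat_add_iff 2).2 (Real.summable_nat_rpow (p := -(3 / 2)) |>.2 (by norm_num))
  refine Summable.mul_left 60 ?_
  simpa using h

/-- The rates of the codes are bounded below. -/
theorem exists_codeLen_le : ∃ K : ℝ, 0 ≤ K ∧ ∀ l, (codeLen bSeq l : ℝ) ≤ K * msgLen bSeq l := by
  refine ⟨Real.exp (∑' i : ℕ, 60 * ((i : ℝ) + 2) ^ (-(3 / 2) : ℝ)), (Real.exp_pos _).le,
    fun l => ?_⟩
  calc (codeLen bSeq l : ℝ)
      ≤ ∏ i ∈ Finset.Icc 1 l,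
        Real.exp (60 * ((i : ℝ) + 2) ^ (-(3 / 2) : ℝ)) * (bSeq i : ℝ) := by
        rw [codeLen, Nat.cast_prod]
        refine Finset.prod_le_prod (fun i _ => by positivity) fun i hi => ?_
        have hi1 := (Finset.mem_Icc.1 hi).1
        have hb : (0 : ℝ) < bSeq i := by
          exact_mod_cast (show 0 < bSeq i by have := two_le_bSeq i hi1; omega)
        calc ((bSeq i + redundancy (bSeq i) : ℕ) : ℝ)
            = (redundancy (bSeq i) / bSeq i + 1) * (bSeq i : ℝ) := by
              push_cast; field_simp; ring
          _ ≤ _ := by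
              refine mul_le_mul_of_nonneg_right ?_ hb.le
              -- Using `1 + x ≤ exp x` turns the product of inverse rates into the exponential of a
              -- convergent sum.
              refine (Real.add_one_le_exp _).trans (Real.exp_le_exp.2 ?_)
              exact redundancy_div_bSeq_le i hi1
    _ = Real.exp (∑ i ∈ Finset.Icc 1 l, 60 * ((i : ℝ) + 2) ^ (-(3 / 2) : ℝ)) * msgLen bSeq l := by
        rw [Finset.prod_mul_distrib, ← Real.exp_sum, msgLen, Nat.cast_prod]
    _ ≤ _ := by
        refine mul_le_mul_of_nonneg_right (Real.exp_le_exp.2 ?_) (by positivity)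
        exact summable_redundancy_div_bSeq.sum_le_tsum _ (fun i _ => by positivity)

theorem msgLen_msgLevel_le (b : ℕ → ℕ) {k : ℕ} (hk : 1 ≤ k) : msgLen b (msgLevel b k) ≤ k :=
  Nat.findGreatest_spec (P := fun l => msgLen b l ≤ k) (Nat.zero_le k) (by rwa [msgLen_zero])

theorem hopLen_maxRelayLevel_lt {t : ℕ → ℕ} {m : ℕ} (h : 0 < maxRelayLevel t m) :
    hopLen t (maxRelayLevel t m) < m := by
  have hne : (Finset.Icc 1 (m - 1)).Nonempty := by
    by_contra hne
    rw [Finset.not_nonempty_iff_eq_empty] at hne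
    simp [maxRelayLevel, hne] at h
  obtain ⟨j, hj, hjm⟩ := Finset.exists_mem_eq_sup _ hne (level t)
  rw [Finset.mem_Icc] at hj
  have := Nat.le_of_dvd hj.1 (hopLen_level_dvd t j)
  rw [maxRelayLevel, hjm]
  omega

theorem exists_transmissionTime_le : ∃ C : ℝ, ∀ m k : ℕ, 1 ≤ m → 1 ≤ k →
    (transmissionTime bSeq tSeq m k : ℝ) ≤ C * (m + k) := by
  obtain ⟨K, hK0, hK⟩ := exists_codeLen_le
  -- The summands pay for the relay delays, for the padded and encoded message, and for a single
  -- top-level block longer than the message.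
  refine ⟨9 / 4 + 2 * K + 1, fun m k hm hk => ?_⟩
  have hd : (delay bSeq tSeq (m - 1) : ℝ) ≤ 9 / 4 * m := by
    refine (delay_le (m - 1)).trans ?_
    have : ((m - 1 : ℕ) : ℝ) ≤ m := by exact_mod_cast Nat.sub_le m 1
    linarith
  have hm0 : (0 : ℝ) ≤ m := by positivity
  have hk0 : (0 : ℝ) ≤ k := by positivity
  rw [transmissionTime, Nat.cast_add, Nat.cast_mul]
  set M := topLevel bSeq tSeq m k with hM
  have hpos : 0 < msgLen bSeq M := (Nat.zero_le M).trans_lt (lt_msgLen two_le_bSeq M)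
  have hend : (numBlocks bSeq tSeq m k : ℝ) * codeLen bSeq M ≤ 2 * K * k + m := by
    -- If a block fits into the message, padding at most doubles the length. If not, one block
    -- suffices and its level is that of some relay, so its code length is below `m`.
    rcases le_or_gt (msgLen bSeq M) k with h | h
    · have h1 : numBlocks bSeq tSeq m k * msgLen bSeq M ≤ 2 * k := by
        rw [numBlocks, ← hM, Nat.ceilDiv_eq_add_pred_div]
        refine (Nat.div_mul_le_self _ _).trans ?_
        omega
      have h2 : (numBlocks bSeq tSeq m k : ℝ) * msgLen bSeq M ≤ 2 * k := by exact_mod_cast h1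
      calc _ ≤ (numBlocks bSeq tSeq m k : ℝ) * (K * msgLen bSeq M) := by
            gcongr
            exact hK M
        _ = K * (numBlocks bSeq tSeq m k * msgLen bSeq M) := by ring
        _ ≤ K * (2 * k) := by gcongr
        _ ≤ _ := by linarith
    · have h1 : numBlocks bSeq tSeq m k ≤ 1 := by
        rw [numBlocks, ← hM, ceilDiv_le_iff_le_smul hpos, smul_eq_mul, mul_one]
        exact h.le
      have h2 : msgLevel bSeq k < M := by
        by_contra hle
        push Not at hle
        have := msgLen_mono two_le_bSeq hle
        have := msgLen_msgLevel_le bSeq hk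
        omega
      have h3 : M = maxRelayLevel tSeq m := by
        rw [hM, topLevel] at h2 ⊢
        omega
      have h4 : hopLen tSeq M < m := by
        rw [h3]
        exact hopLen_maxRelayLevel_lt (by omega)
      have h5 : (codeLen bSeq M : ℝ) ≤ hopLen tSeq M :=
        (codeLen_le_hopLen M).trans
          (mul_le_of_le_one_left (by positivity) (pow_le_one₀ (by norm_num) (by norm_num)))
      have h6 : (hopLen tSeq M : ℝ) ≤ m := by exact_mod_cast h4.le
      have h7 : (numBlocks bSeq tSeq m k : ℝ) ≤ 1 := by exact_mod_cast h1
      calc _ ≤ 1 * (codeLen bSeq M : ℝ) := by gcongr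
        _ ≤ 2 * K * k + m := by
          have : 0 ≤ 2 * K * k := by positivity
          linarith
  have : 0 ≤ 2 * K * m := by positivity
  linarith

end RelayChain

theorem theorem4 :
    -- the total transmission time is `O(m + k)`
    (∃ C : ℝ, ∀ m k : ℕ, 1 ≤ m → 1 ≤ k →
      (RelayChain.transmissionTime RelayChain.bSeq RelayChain.tSeq m k : ℝ) ≤ C * (m + k)) ∧
    -- the error probability tends to `0` as `m → ∞`, whatever `k` and the message are
    (∀ p : unitInterval, (p : ℝ) < (3 : ℝ) ^ (-8 : ℤ) / 4 →
      ∀ ε : ℝ, 0 < ε → ∃ m₀ : ℕ, ∀ (m k : ℕ) (hm : 0 < m), m₀ ≤ m → 1 ≤ k →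
        ∀ msg : Fin k → ZMod 2,
          (RelayChain.multiBitProtocol RelayChain.bSeq RelayChain.tSeq m k).errorProb hm p msg
            ≤ ε) := by
  refine ⟨RelayChain.exists_transmissionTime_le, fun p hp ε hε => ?_⟩
  obtain ⟨M₀, hM₀⟩ := exists_nat_gt (1 / ε)
  -- A chain longer than `hopLen tSeq M₀` has top level at least `M₀`, independently of `k`.
  refine ⟨RelayChain.hopLen RelayChain.tSeq M₀ + 1, fun m k hm hmm _ msg => ?_⟩
  refine (RelayChain.errorProb_multiBitProtocol_le hp.le hm msg).trans ?_
  have hM : M₀ ≤ RelayChain.topLevel RelayChain.bSeq RelayChain.tSeq m k := by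
    by_contra hlt
    push Not at hlt
    have h1 := RelayChain.le_hopLen_topLevel_succ (b := RelayChain.bSeq) RelayChain.two_le_tSeq m k
    have h2 := RelayChain.hopLen_mono RelayChain.two_le_tSeq (Nat.succ_le_of_lt hlt)
    rw [Nat.succ_eq_add_one] at h2
    omega
  have hM' : (M₀ : ℝ) ≤ RelayChain.topLevel RelayChain.bSeq RelayChain.tSeq m k := by
    exact_mod_cast hM
  rw [div_le_iff₀ (by positivity)]
  rw [div_lt_iff₀ hε] at hM₀
  nlinarith
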